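/- Let $H_1,H_2\in(0,1)$ and let $B^{H_1},B^{H_2}$ be two independent fractional Brownian motions on a probability space, indexed by $t\ge 0$, with Hurst parameters $H_1$ and $H_2$; that is, $B^{H}$ is a centered Gaussian process starting from $0$ with covariance $\mathbf E(B^H_tB^H_s)=\tfrac12\left(t^{2H}+s^{2H}-|t-s|^{2H}\right)$. Let $K(x)=\frac1{\sqrt{2\pi}}e^{-x^2/2}$, let $\alpha>0$, and for $n\ge 1$ put $$S_n=\sum_{i=0}^{n-1}K(n^\alpha B^{H_1}_i)\,(B^{H_2}_{i+1}-B^{H_2}_i).$$ Write $\mathbf E(S_n^2)=T_n'+T_n''$, where $$T_n'=\mathbf E\Big(\sum_{i=0}^{n-1}K^2(n^\alpha B^{H_1}_i)(B^{H_2}_{i+1}-B^{H_2}_i)^2\Big),\qquad T_n''=\mathbf E\Big(\sum_{\substack{0\le i,j\le n-1\\ i\ne j}}K(n^\alpha B^{H_1}_i)K(n^\alpha B^{H_1}_j)(B^{H_2}_{i+1}-B^{H_2}_i)(B^{H_2}_{j+1}-B^{H_2}_j)\Big);$$ all these expectations are finite. Suppose that $\alpha-4H_2+H_1+2>0$. Then,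 as $n\to\infty$, $$n^{\alpha+H_1-1}T_n''\longrightarrow 0 .$$ If moreover $\alpha<1-H_1$, then $$n^{\alpha+H_1-1}T_n'\longrightarrow\frac1{2\pi\sqrt2\,(1-H_1)}\qquad\text{and}\qquad n^{\alpha+H_1-1}\,\mathbf E(S_n^2)\longrightarrow\frac1{2\pi\sqrt2\,(1-H_1)} .$$ -/

import Mathlib

open MeasureTheory ProbabilityTheory Filter Topology
open scoped NNReal

namespace FBMRegression

/-- A fractional Brownian motion with Hurst parameter `H`, indexed by `[0, ∞)`: a centered Gaussian
process starting from zero with covariance `(t ^ (2H) + s ^ (2H) - |t - s| ^ (2H)) / 2`. -/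
structure IsFractionalBrownianMotion {Ω : Type*} [MeasurableSpace Ω] (B : ℝ≥0 → Ω → ℝ) (H : ℝ)
    (P : Measure Ω) : Prop where
  gaussian : IsGaussianProcess B P
  start_zero : ∀ᵐ ω ∂P, B 0 ω = 0
  centered : ∀ t, ∫ ω, B t ω ∂P = 0
  covariance_eq : ∀ s t : ℝ≥0, cov[B t, B s; P] =
    1 / 2 * ((t : ℝ) ^ (2 * H) + (s : ℝ) ^ (2 * H) - |(t : ℝ) - (s : ℝ)| ^ (2 * H))

/-- The standard Gaussian kernel. -/
noncomputable def K (x : ℝ) : ℝ := 1 / Real.sqrt (2 * Real.pi) * Real.exp (-x ^ 2 / 2)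

/-- The `i`-th summand `K (n ^ α * B₁ i) * (B₂ (i + 1) - B₂ i)`. -/
noncomputable def summand {Ω : Type*} (B₁ B₂ : ℝ≥0 → Ω → ℝ) (α : ℝ) (n i : ℕ) (ω : Ω) : ℝ :=
  K ((n : ℝ) ^ α * B₁ (i : ℝ≥0) ω) * (B₂ ((i : ℝ≥0) + 1) ω - B₂ (i : ℝ≥0) ω)

/-- `S n = ∑ i = 0, …, n - 1, K (n ^ α * B₁ i) * (B₂ (i + 1) - B₂ i)`. -/
noncomputable def S {Ω : Type*} (B₁ B₂ : ℝ≥0 → Ω → ℝ) (α : ℝ) (n : ℕ) (ω : Ω) : ℝ :=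
  ∑ i ∈ Finset.range n, summand B₁ B₂ α n i ω

/-- The diagonal part of `S n ^ 2`. -/
noncomputable def diagPart {Ω : Type*} (B₁ B₂ : ℝ≥0 → Ω → ℝ) (α : ℝ) (n : ℕ) (ω : Ω) : ℝ :=
  ∑ i ∈ Finset.range n,
    K ((n : ℝ) ^ α * B₁ (i : ℝ≥0) ω) ^ 2 * (B₂ ((i : ℝ≥0) + 1) ω - B₂ (i : ℝ≥0) ω) ^ 2

/-- The off-diagonal part of `S n ^ 2`: the sum over the ordered pairs `(i, j)` with `i ≠ j` and
`0 ≤ i, j ≤ n - 1`. -/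
noncomputable def offDiagPart {Ω : Type*} (B₁ B₂ : ℝ≥0 → Ω → ℝ) (α : ℝ) (n : ℕ) (ω : Ω) : ℝ :=
  ∑ p ∈ (Finset.range n).offDiag, summand B₁ B₂ α n p.1 ω * summand B₁ B₂ α n p.2 ω

end FBMRegression

namespace FBMRegression

/-! ### Elementary inequalities for powers -/

/-! Independence splits each term of the second moment into a kernel expectation for `B₁` and an
increment covariance for `B₂`.

On the diagonal the covariance is `1` and the kernel expectation is explicit
(`integral_K_sq_gaussianReal`). For `i ≥ 1` it is close to `(2π√2 n^α i^H₁)⁻¹`, and the sum of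
`i^(-H₁)` grows like `n^(1-H₁)/(1-H₁)`. The term `i = 0` contributes only `O(1)`, negligible when `α
< 1 - H₁`.

Off the diagonal, at gap `r`, the covariance is at most `r^(2H₂-2)`. The kernel expectation is at
most `n^(-2α)` times a bound of the joint density of `(B₁ i, B₁ (i+r))`, hence `O(n^(-2α) i^(-H₁)
r^(-H₁))` by the determinant estimate `le_covariance_det`. For `i = 0` the law is degenerate and
only `n^(-α) r^(-H₁)` remains. These bounds factor in `i` and `r`, so the double sum is controlled
by a product of two power sums. -/

lemma rpow_eq_sq_rpow_half {x : ℝ} (hx : 0 ≤ x) (p : ℝ) : x ^ p = (x ^ 2) ^ (p / 2) := by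
  rw [← Real.rpow_natCast_mul hx]
  congr 1
  push_cast
  ring

/-- Below: AM-GM gives `2(1-x²)^(p/2) ≥ 2(1-x²)`. Above: Bernoulli with exponent `p/2 ≤ 1` applied
to `(1±x)²`, where the linear terms cancel. Unlike a Taylor expansion, this reaches `x = 1`, the
case of adjacent increments. -/
lemma abs_one_add_rpow_add_one_sub_rpow_sub_two_le {p x : ℝ} (hp0 : 0 ≤ p) (hp2 : p ≤ 2)
    (hx0 : 0 ≤ x) (hx1 : x ≤ 1) : |(1 + x) ^ p + (1 - x) ^ p - 2| ≤ 2 * x ^ 2 := by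
  rw [abs_le]
  constructor
  · have h1 : (1 + x) ^ p = ((1 + x) ^ (p / 2)) ^ 2 := by
      rw [← Real.rpow_mul_natCast (by linarith)]
      congr 1
      push_cast
      ring
    have h2 : (1 - x) ^ p = ((1 - x) ^ (p / 2)) ^ 2 := by
      rw [← Real.rpow_mul_natCast (by linarith)]
      congr 1
      push_cast
      ring
    have h3 : (1 + x) ^ (p / 2) * (1 - x) ^ (p / 2) = (1 - x ^ 2) ^ (p / 2) := by
      rw [← Real.mul_rpow (by linarith) (by linarith)]
      congr 1
      ring
    have h4 : (1 - x ^ 2) ^ (1 : ℝ) ≤ (1 - x ^ 2) ^ (p / 2) :=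
      Real.rpow_le_rpow_of_exponent_ge' (by nlinarith) (by nlinarith) (by linarith) (by linarith)
    rw [Real.rpow_one] at h4
    rw [h1, h2]
    nlinarith [sq_nonneg ((1 + x) ^ (p / 2) - (1 - x) ^ (p / 2))]
  · have h1 : (1 + x) ^ p ≤ 1 + p / 2 * (2 * x + x ^ 2) := by
      rw [rpow_eq_sq_rpow_half (by linarith) p, show (1 + x) ^ 2 = 1 + (2 * x + x ^ 2) by ring]
      exact rpow_one_add_le_one_add_mul_self (by nlinarith) (by linarith) (by linarith)
    have h2 : (1 - x) ^ p ≤ 1 + p / 2 * (-2 * x + x ^ 2) := by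
      rw [rpow_eq_sq_rpow_half (by linarith) p, show (1 - x) ^ 2 = 1 + (-2 * x + x ^ 2) by ring]
      exact rpow_one_add_le_one_add_mul_self (by nlinarith) (by linarith) (by linarith)
    nlinarith [sq_nonneg x]

lemma abs_second_difference_rpow_le {p k : ℝ} (hp0 : 0 ≤ p) (hp2 : p ≤ 2) (hk : 1 ≤ k) :
    |1 / 2 * ((k + 1) ^ p + (k - 1) ^ p - 2 * k ^ p)| ≤ k ^ (p - 2) := by
  have hk0 : 0 < k := by linarith
  have h1 : (k + 1) ^ p = k ^ p * (1 + k⁻¹) ^ p := by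
    rw [← Real.mul_rpow hk0.le (by positivity)]
    congr 1
    field_simp
  have h2 : (k - 1) ^ p = k ^ p * (1 - k⁻¹) ^ p := by
    rw [← Real.mul_rpow hk0.le (by linarith [inv_le_one_of_one_le₀ hk])]
    congr 1
    field_simp
  have h3 := abs_one_add_rpow_add_one_sub_rpow_sub_two_le hp0 hp2 (inv_nonneg.2 hk0.le)
    (inv_le_one_of_one_le₀ hk)
  have hp := Real.rpow_pos_of_pos hk0 p
  rw [h1, h2, show 1 / 2 * (k ^ p * (1 + k⁻¹) ^ p + k ^ p * (1 - k⁻¹) ^ p - 2 * k ^ p)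
    = k ^ p / 2 * ((1 + k⁻¹) ^ p + (1 - k⁻¹) ^ p - 2) by ring, abs_mul, abs_of_pos (by positivity),
    Real.rpow_sub hk0, Real.rpow_two]
  calc k ^ p / 2 * |(1 + k⁻¹) ^ p + (1 - k⁻¹) ^ p - 2|
      ≤ k ^ p / 2 * (2 * k⁻¹ ^ 2) := by gcongr
    _ = k ^ p / k ^ 2 := by field_simp

/-- Both `2x` and `y` lie between `x` and `x + y`, with complementary weights `x/y` and `1 - x/y`.
Adding the two concavity inequalities gives `x^H + (x+y)^H ≤ (2x)^H + y^H`. -/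
lemma mul_min_rpow_le {H x y : ℝ} (hH0 : 0 ≤ H) (hH1 : H ≤ 1) (hx : 0 < x) (hxy : x ≤ y) :
    (2 - 2 ^ H) * x ^ H ≤ x ^ H + y ^ H - (x + y) ^ H := by
  have hc := Real.concaveOn_rpow hH0 hH1
  have hy : 0 < y := hx.trans_le hxy
  have hl : x / y ≤ 1 := (div_le_one hy).2 hxy
  have h0 : 0 ≤ x / y := by positivity
  have hmx : x ∈ Set.Ici (0 : ℝ) := hx.le
  have hms : x + y ∈ Set.Ici (0 : ℝ) := (add_pos hx hy).le
  have h1 := hc.2 hmx hms (sub_nonneg.2 hl) h0 (by ring)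
  have h2 := hc.2 hmx hms h0 (sub_nonneg.2 hl) (by ring)
  simp only [smul_eq_mul] at h1 h2
  rw [show (1 - x / y) * x + x / y * (x + y) = 2 * x by field_simp; ring,
    Real.mul_rpow (by norm_num) hx.le] at h1
  rw [show x / y * x + (1 - x / y) * (x + y) = y by field_simp; ring] at h2
  linarith

lemma two_sub_two_rpow_pos {H : ℝ} (hH : H < 1) : 0 < 2 - (2 : ℝ) ^ H := by
  have := Real.rpow_lt_rpow_of_exponent_lt (x := 2) (by norm_num) hH
  rw [Real.rpow_one] at this
  linarith

/-- A lower bound for the determinant of the covariance matrix of `(B s, B (s + r))`. -/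
lemma le_covariance_det {H s r : ℝ} (hH0 : 0 < H) (hH1 : H < 1) (hs : 0 < s) (hr : 0 < r) :
    (2 - 2 ^ H) / 4 * (s ^ H * r ^ H) ^ 2 ≤ s ^ (2 * H) * (s + r) ^ (2 * H) -
      (1 / 2 * ((s + r) ^ (2 * H) + s ^ (2 * H) - r ^ (2 * H))) ^ 2 := by
  have hsq : ∀ x : ℝ, 0 < x → x ^ (2 * H) = (x ^ H) ^ 2 := fun x hx ↦ by
    rw [← Real.rpow_mul_natCast hx.le]
    congr 1
    push_cast
    ring
  have hκ := two_sub_two_rpow_pos hH1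
  rw [hsq s hs, hsq r hr, hsq _ (add_pos hs hr)]
  have hsb : s ^ H ≤ (s + r) ^ H := Real.rpow_le_rpow hs.le (by linarith) hH0.le
  have hrb : r ^ H ≤ (s + r) ^ H := Real.rpow_le_rpow hr.le (by linarith) hH0.le
  have ha := Real.rpow_pos_of_pos hs H
  have hc := Real.rpow_pos_of_pos hr H
  have hmin : (2 - 2 ^ H) * min (s ^ H) (r ^ H) ≤ s ^ H + r ^ H - (s + r) ^ H := by
    rcases le_total s r with h | h
    · rw [min_eq_left (Real.rpow_le_rpow hs.le h hH0.le)]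
      exact mul_min_rpow_le hH0.le hH1.le hs h
    · rw [min_eq_right (Real.rpow_le_rpow hr.le h hH0.le)]
      have := mul_min_rpow_le hH0.le hH1.le hr h
      rw [add_comm r s] at this
      linarith
  generalize s ^ H = a at *
  generalize r ^ H = c at *
  generalize (s + r) ^ H = b at *
  generalize (2 : ℝ) - 2 ^ H = κ at *
  have hb : 0 < b := ha.trans_le hsb
  -- Heron's factorization: the right side is four times the determinant. The last factor is the
  -- delicate one, bounded below by `hmin`; the others dominate `max a c`, `a` and `c`.
  have key : κ * (a * c) ^ 2 ≤ (a + b + c) * (a + b - c) * (b + c - a) * (a + c - b) := by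
    calc κ * (a * c) ^ 2 = max a c * a * c * (κ * min a c) := by
          rw [show max a c * a * c * (κ * min a c) = κ * (a * c) * (min a c * max a c) by ring,
            min_mul_max]
          ring
      _ ≤ (a + b + c) * (a + b - c) * (b + c - a) * (a + c - b) := by
          have h1 : max a c ≤ a + b + c := max_le (by linarith) (by linarith)
          have h2 : a ≤ a + b - c := by linarith
          have h3 : c ≤ b + c - a := by linarith
          have h4 : 0 < min a c := lt_min ha hc
          have h5 : 0 < max a c := lt_max_of_lt_left ha
          have h6 : 0 < a + b - c := by linarith
          have h7 : 0 < b + c - a := by linarith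
          gcongr
  nlinarith [key]

/-! ### Finite sums -/

/-- By Bernoulli, each term is at most the increment of `x^δ/δ` over `[k, k+1]`; the lower bound
below uses `[k+1, k+2]` instead. -/
lemma sum_rpow_sub_one_le {δ : ℝ} (hδ0 : 0 < δ) (hδ1 : δ ≤ 1) (n : ℕ) :
    ∑ k ∈ Finset.range n, ((k : ℝ) + 1) ^ (δ - 1) ≤ (n : ℝ) ^ δ / δ := by
  induction n with
  | zero => simp [Real.zero_rpow hδ0.ne']
  | succ n ih =>
    rw [Finset.sum_range_succ]
    have hn : (0 : ℝ) < n + 1 := by positivity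
    have hle : ((n : ℝ) + 1)⁻¹ ≤ 1 := inv_le_one_of_one_le₀ (by linarith [n.cast_nonneg (α := ℝ)])
    have h := rpow_one_add_le_one_add_mul_self (s := -((n : ℝ) + 1)⁻¹) (by linarith)
      hδ0.le hδ1
    have hmul : (n : ℝ) ^ δ = ((n : ℝ) + 1) ^ δ * (1 + -((n : ℝ) + 1)⁻¹) ^ δ := by
      rw [← Real.mul_rpow hn.le (by linarith)]
      congr 1
      field_simp
      ring
    have hpos := Real.rpow_pos_of_pos hn δ
    have h2 : (n : ℝ) ^ δ ≤ ((n : ℝ) + 1) ^ δ - δ * ((n : ℝ) + 1) ^ (δ - 1) := by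
      rw [hmul, Real.rpow_sub_one hn.ne']
      calc _ ≤ ((n : ℝ) + 1) ^ δ * (1 + δ * -((n : ℝ) + 1)⁻¹) := by gcongr
        _ = _ := by field_simp; ring
    push_cast
    rw [le_div_iff₀ hδ0] at *
    linarith

lemma le_sum_rpow_sub_one {δ : ℝ} (hδ0 : 0 < δ) (hδ1 : δ ≤ 1) (n : ℕ) :
    (((n : ℝ) + 1) ^ δ - 1) / δ ≤ ∑ k ∈ Finset.range n, ((k : ℝ) + 1) ^ (δ - 1) := by
  induction n with
  | zero => simp
  | succ n ih =>
    rw [Finset.sum_range_succ]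
    have hn : (0 : ℝ) < n + 1 := by positivity
    have h := rpow_one_add_le_one_add_mul_self (s := ((n : ℝ) + 1)⁻¹)
      (by linarith [inv_pos.2 hn]) hδ0.le hδ1
    have hmul : ((n : ℝ) + 1 + 1) ^ δ = ((n : ℝ) + 1) ^ δ * (1 + ((n : ℝ) + 1)⁻¹) ^ δ := by
      rw [← Real.mul_rpow hn.le (by positivity)]
      congr 1
      field_simp
    have hpos := Real.rpow_pos_of_pos hn δ
    have h2 : ((n : ℝ) + 1 + 1) ^ δ ≤ ((n : ℝ) + 1) ^ δ + δ * ((n : ℝ) + 1) ^ (δ - 1) := by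
      rw [hmul, Real.rpow_sub_one hn.ne']
      calc _ ≤ ((n : ℝ) + 1) ^ δ * (1 + δ * ((n : ℝ) + 1)⁻¹) := by gcongr
        _ = _ := by field_simp
    push_cast
    rw [div_le_iff₀ hδ0] at *
    linarith

lemma sum_offDiag_range_le {f : ℕ → ℕ → ℝ} {F G : ℕ → ℝ} (hsymm : ∀ i j, f i j = f j i)
    (hF : ∀ i, 0 ≤ F i) (hG : ∀ k, 0 ≤ G k) (hf : ∀ i k, f i (i + 1 + k) ≤ F i * G k) (n : ℕ) :
    ∑ p ∈ (Finset.range n).offDiag, f p.1 p.2 ≤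
      2 * ((∑ i ∈ Finset.range n, F i) * ∑ k ∈ Finset.range n, G k) := by
  have hrow : ∑ i ∈ Finset.range n, ∑ j ∈ Finset.range n with i < j, f i j ≤
      (∑ i ∈ Finset.range n, F i) * ∑ k ∈ Finset.range n, G k := by
    rw [Finset.sum_mul]
    refine Finset.sum_le_sum fun i _ ↦ ?_
    have hI : {j ∈ Finset.range n | i < j} = Finset.Ico (i + 1) n := by
      ext j
      simp only [Finset.mem_filter, Finset.mem_range, Finset.mem_Ico]
      omega
    rw [hI, Finset.sum_Ico_eq_sum_range, Finset.mul_sum]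
    -- The range of gaps is enlarged to all `k < n`, independent of `i`, so that the double sum
    -- becomes a product.
    calc _ ≤ ∑ k ∈ Finset.range (n - (i + 1)), F i * G k := Finset.sum_le_sum fun k _ ↦ hf i k
      _ ≤ _ := Finset.sum_le_sum_of_subset_of_nonneg
          (Finset.range_mono (Nat.sub_le _ _)) fun k _ _ ↦ mul_nonneg (hF i) (hG k)
  have hsplit : ∑ p ∈ (Finset.range n).offDiag, f p.1 p.2 =
      ∑ i ∈ Finset.range n, ∑ j ∈ Finset.range n with i < j, f i j +
        ∑ i ∈ Finset.range n, ∑ j ∈ Finset.range n with i < j, f j i := by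
    have hoff : (Finset.range n).offDiag =
        {p ∈ Finset.range n ×ˢ Finset.range n | p.1 ≠ p.2} := by
      ext p
      simp [and_assoc]
    rw [hoff]
    simp only [Finset.sum_filter, Finset.sum_product]
    rw [Finset.sum_comm (f := fun i j ↦ if i < j then f j i else 0), ← Finset.sum_add_distrib]
    refine Finset.sum_congr rfl fun i _ ↦ ?_
    rw [← Finset.sum_add_distrib]
    refine Finset.sum_congr rfl fun j _ ↦ ?_
    rcases lt_trichotomy i j with h | h | h
    · simp [h, h.ne, h.not_gt]
    · simp [h]
    · simp [h, h.ne', h.not_gt]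
  have hcol : ∑ i ∈ Finset.range n, ∑ j ∈ Finset.range n with i < j, f j i =
      ∑ i ∈ Finset.range n, ∑ j ∈ Finset.range n with i < j, f i j :=
    Finset.sum_congr rfl fun i _ ↦ Finset.sum_congr rfl fun j _ ↦ hsymm j i
  rw [hsplit, hcol]
  linarith

/-! ### Gaussian expectations of the kernel -/

lemma K_nonneg (x : ℝ) : 0 ≤ K x := by unfold K; positivity

lemma continuous_K : Continuous K := by unfold K; fun_prop

lemma K_le_one (x : ℝ) : K x ≤ 1 := by
  unfold K
  have h1 : 1 ≤ Real.sqrt (2 * Real.pi) := Real.one_le_sqrt.2 (by linarith [Real.pi_gt_three])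
  have h2 : Real.exp (-x ^ 2 / 2) ≤ 1 := Real.exp_le_one_iff.2 (by nlinarith [sq_nonneg x])
  exact mul_le_one₀ ((div_le_one (by positivity)).2 h1) (Real.exp_pos _).le h2

lemma norm_K_le_one (x : ℝ) : ‖K x‖ ≤ 1 := by
  rw [Real.norm_of_nonneg (K_nonneg x)]
  exact K_le_one x

lemma K_eq_gaussianPDFReal : K = gaussianPDFReal 0 1 := by
  ext x
  simp [K, gaussianPDFReal]

lemma integrable_K_comp {a b : ℝ} (ha : 0 < a) : Integrable (fun x ↦ K (a * x + b)) := by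
  rw [K_eq_gaussianPDFReal]
  exact ((integrable_gaussianPDFReal 0 1).comp_add_right b).comp_mul_left' ha.ne'

lemma integral_K_comp {a b : ℝ} (ha : 0 < a) : ∫ x, K (a * x + b) = a⁻¹ := by
  rw [Measure.integral_comp_mul_left (fun x ↦ K (x + b)) a, integral_add_right_eq_self,
    K_eq_gaussianPDFReal, integral_gaussianPDFReal_eq_one 0 one_ne_zero]
  simp [abs_of_pos ha]

lemma gaussianPDFReal_le (m : ℝ) (v : ℝ≥0) (x : ℝ) :
    gaussianPDFReal m v x ≤ (Real.sqrt (2 * Real.pi * v))⁻¹ := by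
  rw [gaussianPDFReal]
  refine mul_le_of_le_one_right (by positivity) (Real.exp_le_one_iff.2 ?_)
  exact div_nonpos_of_nonpos_of_nonneg (neg_nonpos.2 (sq_nonneg _)) (by positivity)

/-- The density is at most its peak and the rescaled kernel has mass `a⁻¹`. Uniformity in the shift
`b` is what allows conditioning in `integral_K_mul_K_le`. -/
lemma integral_K_gaussianReal_le {a : ℝ} (ha : 0 < a) (b m : ℝ) {v : ℝ≥0} (hv : v ≠ 0) :
    ∫ x, K (a * x + b) ∂gaussianReal m v ≤ (a * Real.sqrt (2 * Real.pi * v))⁻¹ := by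
  rw [integral_gaussianReal_eq_integral_smul hv]
  calc ∫ x, gaussianPDFReal m v x • K (a * x + b)
      ≤ ∫ x, (Real.sqrt (2 * Real.pi * v))⁻¹ * K (a * x + b) := by
        refine integral_mono_of_nonneg (ae_of_all _ fun x ↦ ?_)
          ((integrable_K_comp ha).const_mul _) (ae_of_all _ fun x ↦ ?_)
        · exact smul_nonneg (gaussianPDFReal_nonneg m v x) (K_nonneg _)
        · exact mul_le_mul_of_nonneg_right (gaussianPDFReal_le m v x) (K_nonneg _)
    _ = _ := by rw [integral_const_mul, integral_K_comp ha, mul_inv]; ring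

lemma integral_K_sq_gaussianReal (a : ℝ) (v : ℝ≥0) :
    ∫ x, K (a * x) ^ 2 ∂gaussianReal 0 v =
      (2 * Real.pi)⁻¹ * (Real.sqrt (1 + 2 * a ^ 2 * v))⁻¹ := by
  have hπ := Real.pi_pos
  have hK : ∀ x, K (a * x) ^ 2 = (2 * Real.pi)⁻¹ * Real.exp (-a ^ 2 * x ^ 2) := fun x ↦ by
    rw [K, mul_pow, div_pow, Real.sq_sqrt (by positivity), ← Real.exp_nat_mul]
    congr 2
    · simp
    · push_cast
      ring
  -- A Dirac mass has no density; this case is the diagonal term at time zero.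
  rcases eq_or_ne v 0 with rfl | hv
  · simp [hK]
  have hv0 : (0 : ℝ) < v := by positivity
  rw [integral_gaussianReal_eq_integral_smul hv]
  have hfun : (fun x ↦ gaussianPDFReal 0 v x • K (a * x) ^ 2) = fun x ↦
      (2 * Real.pi)⁻¹ * (Real.sqrt (2 * Real.pi * v))⁻¹ *
        Real.exp (-((1 + 2 * a ^ 2 * v) / (2 * v)) * x ^ 2) := by
    ext x
    rw [hK, gaussianPDFReal, smul_eq_mul, mul_mul_mul_comm, ← Real.exp_add, sub_zero,
      mul_comm (Real.sqrt _)⁻¹]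
    congr 2
    field_simp
    ring
  rw [hfun, integral_const_mul, integral_gaussian, mul_assoc]
  congr 1
  rw [← Real.sqrt_inv, ← Real.sqrt_inv, ← Real.sqrt_mul (by positivity)]
  congr 1
  field_simp

variable {Ω : Type*} [MeasurableSpace Ω] {P : Measure Ω}

lemma integrable_K_comp_of_aemeasurable [IsFiniteMeasure P] {X : Ω → ℝ} (hX : AEMeasurable X P) :
    Integrable (fun ω ↦ K (X ω)) P :=
  Integrable.of_bound (continuous_K.measurable.comp_aemeasurable hX).aestronglyMeasurable 1
    (ae_of_all _ fun _ ↦ norm_K_le_one _)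

lemma integral_K_le_of_hasGaussianLaw {X : Ω → ℝ} (hX : HasGaussianLaw X P) {a : ℝ} (ha : 0 < a)
    (b : ℝ) (hv : 0 < Var[X; P]) :
    ∫ ω, K (a * X ω + b) ∂P ≤ (a * Real.sqrt (2 * Real.pi * Var[X; P]))⁻¹ := by
  have h := integral_K_gaussianReal_le ha b (∫ ω, X ω ∂P) (Real.toNNReal_pos.2 hv).ne'
  rw [Real.coe_toNNReal _ hv.le, ← hX.map_eq_gaussianReal, integral_map hX.aemeasurable
    (by have := continuous_K; fun_prop)] at h
  exact h

lemma integral_K_mul_K_le {X Y : Ω → ℝ} (hXY : HasGaussianLaw (fun ω ↦ (X ω, Y ω)) P) {a : ℝ}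
    (ha : 0 < a) (hX0 : 0 < Var[X; P]) (hdet : 0 < Var[X; P] * Var[Y; P] - cov[X, Y; P] ^ 2) :
    ∫ ω, K (a * X ω) * K (a * Y ω) ∂P ≤
      (a ^ 2 * (2 * Real.pi) * Real.sqrt (Var[X; P] * Var[Y; P] - cov[X, Y; P] ^ 2))⁻¹ := by
  have := hXY.isProbabilityMeasure
  have hK := continuous_K
  have hπ := Real.pi_pos
  have hX := hXY.fst
  have hY := hXY.snd
  -- Regression coefficient of `Y` on `X`: the residual `Z` is uncorrelated with `X`, hence
  -- independent by joint Gaussianity, and its variance is the determinant over `Var[X]`. The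
  -- one-dimensional bound then applies twice.
  set c := cov[X, Y; P] / Var[X; P] with hc
  set Z : Ω → ℝ := fun ω ↦ Y ω - c * X ω with hZ
  have hXZ : HasGaussianLaw (fun ω ↦ (X ω, Z ω)) P :=
    hXY.map_fun ((ContinuousLinearMap.fst ℝ ℝ ℝ).prod
      (ContinuousLinearMap.snd ℝ ℝ ℝ - c • ContinuousLinearMap.fst ℝ ℝ ℝ))
  have hZg := hXZ.snd
  have hcX : MemLp (fun ω ↦ c * X ω) 2 P := hX.memLp_two.const_mul c
  have hcov : cov[X, Z; P] = 0 := by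
    rw [hZ, covariance_fun_sub_right hX.memLp_two hY.memLp_two hcX, covariance_const_mul_right,
      covariance_self hX.aemeasurable, hc]
    field_simp
    ring
  have hvar : Var[Z; P] = (Var[X; P] * Var[Y; P] - cov[X, Y; P] ^ 2) / Var[X; P] := by
    rw [hZ, variance_fun_sub hY.memLp_two hcX, covariance_const_mul_right, variance_const_mul,
      covariance_comm, hc]
    field_simp
    ring
  have hZ0 : 0 < Var[Z; P] := hvar ▸ div_pos hdet hX0
  have hind := hXZ.indepFun_of_covariance_eq_zero hcov
  have hmap := (indepFun_iff_map_prod_eq_prod_map_map hX.aemeasurable hZg.aemeasurable).1 hind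
  have := Measure.isProbabilityMeasure_map hX.aemeasurable
  have := Measure.isProbabilityMeasure_map hZg.aemeasurable
  have hbound : ∀ x : ℝ × ℝ, ‖K (a * x.1) * K (a * (x.2 + c * x.1))‖ ≤ 1 := fun x ↦ by
    rw [norm_mul]
    exact mul_le_one₀ (norm_K_le_one _) (norm_nonneg _) (norm_K_le_one _)
  have hint : Integrable (fun x : ℝ × ℝ ↦ K (a * x.1) * K (a * (x.2 + c * x.1)))
      ((P.map X).prod (P.map Z)) :=
    Integrable.of_bound (by fun_prop) 1 (ae_of_all _ hbound)
  have hinner : ∀ x, ∫ z, K (a * x) * K (a * (z + c * x)) ∂(P.map Z) ≤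
      K (a * x) * (a * Real.sqrt (2 * Real.pi * Var[Z; P]))⁻¹ := fun x ↦ by
    rw [integral_const_mul]
    refine mul_le_mul_of_nonneg_left ?_ (K_nonneg _)
    rw [integral_map hZg.aemeasurable (by fun_prop)]
    simpa only [mul_add] using integral_K_le_of_hasGaussianLaw hZg ha (a * (c * x)) hZ0
  calc ∫ ω, K (a * X ω) * K (a * Y ω) ∂P
      = ∫ x : ℝ × ℝ, K (a * x.1) * K (a * (x.2 + c * x.1)) ∂((P.map X).prod (P.map Z)) := by
        rw [← hmap, integral_map hXZ.aemeasurable (by fun_prop)]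
        simp [hZ]
    _ = ∫ x, ∫ z, K (a * x) * K (a * (z + c * x)) ∂(P.map Z) ∂(P.map X) := integral_prod _ hint
    _ ≤ ∫ x, K (a * x) * (a * Real.sqrt (2 * Real.pi * Var[Z; P]))⁻¹ ∂(P.map X) :=
        integral_mono hint.integral_prod_left
          ((integrable_K_comp_of_aemeasurable (by fun_prop)).mul_const _) hinner
    _ = (∫ ω, K (a * X ω + 0) ∂P) * (a * Real.sqrt (2 * Real.pi * Var[Z; P]))⁻¹ := by
        rw [integral_mul_const, integral_map hX.aemeasurable (by fun_prop)]
        simp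
    _ ≤ (a * Real.sqrt (2 * Real.pi * Var[X; P]))⁻¹ *
          (a * Real.sqrt (2 * Real.pi * Var[Z; P]))⁻¹ :=
        mul_le_mul_of_nonneg_right (integral_K_le_of_hasGaussianLaw hX ha 0 hX0) (by positivity)
    _ = _ := by
        rw [← mul_inv, mul_mul_mul_comm, ← Real.sqrt_mul (by positivity), hvar,
          show 2 * Real.pi * Var[X; P] * (2 * Real.pi *
            ((Var[X; P] * Var[Y; P] - cov[X, Y; P] ^ 2) / Var[X; P])) =
            (2 * Real.pi) ^ 2 * (Var[X; P] * Var[Y; P] - cov[X, Y; P] ^ 2) by field_simp,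
          Real.sqrt_mul (by positivity), Real.sqrt_sq (by positivity)]
        ring

/-! ### Moments of fractional Brownian motion -/

namespace IsFractionalBrownianMotion

variable {B : ℝ≥0 → Ω → ℝ} {H : ℝ}

lemma aemeasurable (hB : IsFractionalBrownianMotion B H P) (t : ℝ≥0) : AEMeasurable (B t) P :=
  hB.gaussian.aemeasurable t

lemma memLp (hB : IsFractionalBrownianMotion B H P) (t : ℝ≥0) : MemLp (B t) 2 P :=
  (hB.gaussian.hasGaussianLaw_eval t).memLp_two

lemma variance_eq (hB : IsFractionalBrownianMotion B H P) (hH : 0 < H) (t : ℝ≥0) :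
    Var[B t; P] = (t : ℝ) ^ (2 * H) := by
  rw [← covariance_self (hB.aemeasurable t), hB.covariance_eq, sub_self, abs_zero,
    Real.zero_rpow (by positivity)]
  ring

lemma integral_increment (hB : IsFractionalBrownianMotion B H P) (s t : ℝ≥0) :
    ∫ ω, (B t ω - B s ω) ∂P = 0 := by
  have := hB.gaussian.isProbabilityMeasure
  rw [integral_sub ((hB.memLp t).integrable one_le_two) ((hB.memLp s).integrable one_le_two),
    hB.centered, hB.centered, sub_self]

lemma integral_increment_mul_increment (hB : IsFractionalBrownianMotion B H P)
    (s t u v : ℝ≥0) : ∫ ω, (B t ω - B s ω) * (B v ω - B u ω) ∂P =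
      1 / 2 * (|(t : ℝ) - u| ^ (2 * H) + |(s : ℝ) - v| ^ (2 * H) -
        |(t : ℝ) - v| ^ (2 * H) - |(s : ℝ) - u| ^ (2 * H)) := by
  have := hB.gaussian.isProbabilityMeasure
  have h := covariance_eq_sub ((hB.memLp t).sub (hB.memLp s)) ((hB.memLp v).sub (hB.memLp u))
  simp only [Pi.mul_apply, Pi.sub_apply, hB.integral_increment, mul_zero, sub_zero] at h
  rw [← h, covariance_sub_sub (hB.memLp t) (hB.memLp s) (hB.memLp v) (hB.memLp u),
    hB.covariance_eq, hB.covariance_eq, hB.covariance_eq, hB.covariance_eq]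
  ring

lemma integral_unit_increment_sq (hB : IsFractionalBrownianMotion B H P) (hH : 0 < H)
    (t : ℝ≥0) : ∫ ω, (B (t + 1) ω - B t ω) ^ 2 ∂P = 1 := by
  have h := hB.integral_increment_mul_increment t (t + 1) t (t + 1)
  simp only [← pow_two] at h
  rw [h]
  have : (2 * H) ≠ 0 := by positivity
  simp [Real.zero_rpow this]
  norm_num

lemma abs_integral_unit_increment_mul_le (hB : IsFractionalBrownianMotion B H P) (hH0 : 0 < H)
    (hH1 : H < 1) (t : ℝ≥0) {r : ℝ≥0} (hr : 1 ≤ r) :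
    |∫ ω, (B (t + 1) ω - B t ω) * (B (t + r + 1) ω - B (t + r) ω) ∂P| ≤
      (r : ℝ) ^ (2 * H - 2) := by
  have hr' : (1 : ℝ) ≤ r := hr
  rw [hB.integral_increment_mul_increment]
  push_cast
  rw [show (t : ℝ) + 1 - (t + r) = -(r - 1) by ring, show (t : ℝ) - (t + r + 1) = -(r + 1) by ring,
    show (t : ℝ) + 1 - (t + r + 1) = -r by ring, show (t : ℝ) - (t + r) = -r by ring,
    abs_neg, abs_neg, abs_neg, abs_of_nonneg (sub_nonneg.2 hr'),
    abs_of_nonneg (show (0 : ℝ) ≤ (r : ℝ) + 1 by positivity), NNReal.abs_eq]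
  refine le_trans (le_of_eq ?_)
    (abs_second_difference_rpow_le (p := 2 * H) (by linarith) (by linarith) hr')
  congr 1
  ring

lemma integral_K_sq (hB : IsFractionalBrownianMotion B H P) (hH : 0 < H) (a : ℝ) (t : ℝ≥0) :
    ∫ ω, K (a * B t ω) ^ 2 ∂P =
      (2 * Real.pi)⁻¹ * (Real.sqrt (1 + 2 * a ^ 2 * (t : ℝ) ^ (2 * H)))⁻¹ := by
  have h := integral_K_sq_gaussianReal a (Var[B t; P]).toNNReal
  have hlaw := (hB.gaussian.hasGaussianLaw_eval t).map_eq_gaussianReal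
  rw [hB.centered] at hlaw
  rw [Real.coe_toNNReal _ (variance_nonneg _ _), ← hlaw, integral_map (hB.aemeasurable t)
    (by have := continuous_K; fun_prop), hB.variance_eq hH] at h
  exact h

/-- Meant for `s = 0`, where the covariance matrix is singular: one kernel is bounded by `1`, at the
cost of one factor `a⁻¹`. -/
lemma integral_K_mul_K_le_one (hB : IsFractionalBrownianMotion B H P) (hH : 0 < H) {a : ℝ}
    (ha : 0 < a) (s : ℝ≥0) {t : ℝ≥0} (ht : 0 < t) :
    ∫ ω, K (a * B s ω) * K (a * B t ω) ∂P ≤ a⁻¹ * (t : ℝ) ^ (-H) := by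
  have := hB.gaussian.isProbabilityMeasure
  have ht' : (0 : ℝ) < t := ht
  have hpow := Real.rpow_pos_of_pos ht' H
  have hsq : (t : ℝ) ^ (2 * H) = ((t : ℝ) ^ H) ^ 2 := by
    rw [← Real.rpow_mul_natCast ht'.le]
    congr 1
    push_cast
    ring
  calc ∫ ω, K (a * B s ω) * K (a * B t ω) ∂P ≤ ∫ ω, K (a * B t ω + 0) ∂P := by
        refine integral_mono_of_nonneg (ae_of_all _ fun ω ↦ mul_nonneg (K_nonneg _) (K_nonneg _))
          (integrable_K_comp_of_aemeasurable (((hB.aemeasurable t).const_mul a).add_const 0))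
          (ae_of_all _ fun ω ↦ ?_)
        simpa using mul_le_of_le_one_left (K_nonneg _) (K_le_one _)
    _ ≤ (a * Real.sqrt (2 * Real.pi * Var[B t; P]))⁻¹ :=
        integral_K_le_of_hasGaussianLaw (hB.gaussian.hasGaussianLaw_eval t) ha 0
          (by rw [hB.variance_eq hH]; positivity)
    _ ≤ (a * (t : ℝ) ^ H)⁻¹ := by
        gcongr
        rw [hB.variance_eq hH, hsq]
        refine Real.le_sqrt_of_sq_le ?_
        nlinarith [Real.pi_gt_three, sq_nonneg ((t : ℝ) ^ H)]
    _ = a⁻¹ * (t : ℝ) ^ (-H) := by rw [mul_inv, Real.rpow_neg ht'.le]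

lemma integral_K_mul_K_add_le (hB : IsFractionalBrownianMotion B H P) (hH0 : 0 < H) (hH1 : H < 1)
    {a : ℝ} (ha : 0 < a) {s r : ℝ≥0} (hs : 0 < s) (hr : 0 < r) :
    ∫ ω, K (a * B s ω) * K (a * B (s + r) ω) ∂P ≤
      (Real.sqrt (2 - 2 ^ H))⁻¹ * (a ^ 2)⁻¹ * (s : ℝ) ^ (-H) * (r : ℝ) ^ (-H) := by
  have hs' : (0 : ℝ) < s := hs
  have hr' : (0 : ℝ) < r := hr
  have hκ := two_sub_two_rpow_pos hH1
  have hspow := Real.rpow_pos_of_pos hs' H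
  have hrpow := Real.rpow_pos_of_pos hr' H
  have hdet := le_covariance_det hH0 hH1 hs' hr'
  have hcov : Var[B s; P] * Var[B (s + r); P] - cov[B s, B (s + r); P] ^ 2 =
      (s : ℝ) ^ (2 * H) * ((s : ℝ) + r) ^ (2 * H) -
      (1 / 2 * (((s : ℝ) + r) ^ (2 * H) + (s : ℝ) ^ (2 * H) - (r : ℝ) ^ (2 * H))) ^ 2 := by
    rw [hB.variance_eq hH0, hB.variance_eq hH0, hB.covariance_eq]
    push_cast
    rw [show (s : ℝ) - (s + r) = -r by ring, abs_neg, abs_of_pos hr']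
    ring
  rw [← hcov] at hdet
  have hpos : 0 < (2 - (2 : ℝ) ^ H) / 4 * ((s : ℝ) ^ H * (r : ℝ) ^ H) ^ 2 := by positivity
  have hle := integral_K_mul_K_le (hB.gaussian.hasGaussianLaw_prodMk (s := s) (t := s + r)) ha
    (by rw [hB.variance_eq hH0]; positivity) (hpos.trans_le hdet)
  refine hle.trans ?_
  rw [Real.rpow_neg hs'.le, Real.rpow_neg hr'.le, ← mul_inv, ← mul_inv, ← mul_inv]
  refine inv_anti₀ (by positivity) ?_
  -- The `2` obtained from `2π ≥ 2` cancels the square root of the `1/4` in `le_covariance_det`.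
  calc Real.sqrt (2 - 2 ^ H) * a ^ 2 * (s : ℝ) ^ H * (r : ℝ) ^ H
      = a ^ 2 * 2 * Real.sqrt ((2 - (2 : ℝ) ^ H) / 4 * ((s : ℝ) ^ H * (r : ℝ) ^ H) ^ 2) := by
        rw [Real.sqrt_mul (by positivity), Real.sqrt_sq (by positivity), Real.sqrt_div hκ.le,
          show (4 : ℝ) = 2 ^ 2 by norm_num, Real.sqrt_sq (by norm_num)]
        ring
    _ ≤ _ := by
        gcongr
        linarith [Real.pi_gt_three]

end IsFractionalBrownianMotion

/-! ### The two parts of the second moment -/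

section

variable {B₁ B₂ : ℝ≥0 → Ω → ℝ} {H₁ H₂ : ℝ}

lemma memLp_summand (hB₁ : IsFractionalBrownianMotion B₁ H₁ P)
    (hB₂ : IsFractionalBrownianMotion B₂ H₂ P) (α : ℝ) (n i : ℕ) :
    MemLp (summand B₁ B₂ α n i) 2 P := by
  have hK : AEStronglyMeasurable (fun ω ↦ K ((n : ℝ) ^ α * B₁ (i : ℝ≥0) ω)) P :=
    (continuous_K.measurable.comp_aemeasurable
      ((hB₁.aemeasurable _).const_mul _)).aestronglyMeasurable
  refine ((hB₂.memLp ((i : ℝ≥0) + 1)).sub (hB₂.memLp i)).of_le (hK.mul ?_)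
    (ae_of_all _ fun ω ↦ ?_)
  · exact ((hB₂.aemeasurable _).sub (hB₂.aemeasurable _)).aestronglyMeasurable
  · rw [summand, norm_mul]
    exact mul_le_of_le_one_left (norm_nonneg _) (norm_K_le_one _)

lemma integrable_summand_mul_summand (hB₁ : IsFractionalBrownianMotion B₁ H₁ P)
    (hB₂ : IsFractionalBrownianMotion B₂ H₂ P) (α : ℝ) (n i j : ℕ) :
    Integrable (fun ω ↦ summand B₁ B₂ α n i ω * summand B₁ B₂ α n j ω) P :=
  (memLp_summand hB₁ hB₂ α n i).integrable_mul (memLp_summand hB₁ hB₂ α n j)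

omit [MeasurableSpace Ω] in
lemma diagPart_eq (α : ℝ) (n : ℕ) : diagPart B₁ B₂ α n =
    fun ω ↦ ∑ i ∈ Finset.range n, summand B₁ B₂ α n i ω * summand B₁ B₂ α n i ω := by
  ext ω
  exact Finset.sum_congr rfl fun i _ ↦ by rw [summand]; ring

omit [MeasurableSpace Ω] in
lemma sq_S_eq (α : ℝ) (n : ℕ) (ω : Ω) :
    S B₁ B₂ α n ω ^ 2 = diagPart B₁ B₂ α n ω + offDiagPart B₁ B₂ α n ω := by
  rw [diagPart_eq, S, offDiagPart, pow_two, Finset.sum_mul_sum, ← Finset.sum_product',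
    ← Finset.diag_union_offDiag, Finset.sum_union (Finset.disjoint_diag_offDiag _),
    Finset.sum_diag]

lemma memLp_S (hB₁ : IsFractionalBrownianMotion B₁ H₁ P)
    (hB₂ : IsFractionalBrownianMotion B₂ H₂ P) (α : ℝ) (n : ℕ) : MemLp (S B₁ B₂ α n) 2 P :=
  memLp_finsetSum _ fun i _ ↦ memLp_summand hB₁ hB₂ α n i

lemma integrable_diagPart (hB₁ : IsFractionalBrownianMotion B₁ H₁ P)
    (hB₂ : IsFractionalBrownianMotion B₂ H₂ P) (α : ℝ) (n : ℕ) :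
    Integrable (diagPart B₁ B₂ α n) P := by
  rw [diagPart_eq]
  exact integrable_finsetSum _ fun i _ ↦ integrable_summand_mul_summand hB₁ hB₂ α n i i

lemma integrable_offDiagPart (hB₁ : IsFractionalBrownianMotion B₁ H₁ P)
    (hB₂ : IsFractionalBrownianMotion B₂ H₂ P) (α : ℝ) (n : ℕ) :
    Integrable (offDiagPart B₁ B₂ α n) P :=
  integrable_finsetSum _ fun p _ ↦ integrable_summand_mul_summand hB₁ hB₂ α n p.1 p.2

lemma integral_sq_S (hB₁ : IsFractionalBrownianMotion B₁ H₁ P)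
    (hB₂ : IsFractionalBrownianMotion B₂ H₂ P) (α : ℝ) (n : ℕ) :
    ∫ ω, S B₁ B₂ α n ω ^ 2 ∂P =
      ∫ ω, diagPart B₁ B₂ α n ω ∂P + ∫ ω, offDiagPart B₁ B₂ α n ω ∂P := by
  simp only [sq_S_eq]
  exact integral_add (integrable_diagPart hB₁ hB₂ α n) (integrable_offDiagPart hB₁ hB₂ α n)

lemma integral_summand_mul_summand (hB₁ : IsFractionalBrownianMotion B₁ H₁ P)
    (hB₂ : IsFractionalBrownianMotion B₂ H₂ P)
    (hindep : IndepFun (fun ω t ↦ B₁ t ω) (fun ω t ↦ B₂ t ω) P) (α : ℝ) (n i j : ℕ) :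
    ∫ ω, summand B₁ B₂ α n i ω * summand B₁ B₂ α n j ω ∂P =
      (∫ ω, K ((n : ℝ) ^ α * B₁ (i : ℝ≥0) ω) * K ((n : ℝ) ^ α * B₁ (j : ℝ≥0) ω) ∂P) *
        ∫ ω, (B₂ ((i : ℝ≥0) + 1) ω - B₂ (i : ℝ≥0) ω) *
          (B₂ ((j : ℝ≥0) + 1) ω - B₂ (j : ℝ≥0) ω) ∂P := by
  have hK := continuous_K.measurable
  have h := hindep.comp
    (φ := fun x : ℝ≥0 → ℝ ↦ K ((n : ℝ) ^ α * x (i : ℝ≥0)) * K ((n : ℝ) ^ α * x (j : ℝ≥0)))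
    (ψ := fun x : ℝ≥0 → ℝ ↦ (x ((i : ℝ≥0) + 1) - x (i : ℝ≥0)) *
      (x ((j : ℝ≥0) + 1) - x (j : ℝ≥0))) (by fun_prop) (by fun_prop)
  have hm₁ : AEStronglyMeasurable (fun ω ↦ K ((n : ℝ) ^ α * B₁ (i : ℝ≥0) ω) *
      K ((n : ℝ) ^ α * B₁ (j : ℝ≥0) ω)) P := by
    have := hB₁.aemeasurable i
    have := hB₁.aemeasurable j
    exact AEMeasurable.aestronglyMeasurable (by fun_prop)
  have hm₂ : AEStronglyMeasurable (fun ω ↦ (B₂ ((i : ℝ≥0) + 1) ω - B₂ (i : ℝ≥0) ω) *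
      (B₂ ((j : ℝ≥0) + 1) ω - B₂ (j : ℝ≥0) ω)) P := by
    have := hB₂.aemeasurable i
    have := hB₂.aemeasurable j
    have := hB₂.aemeasurable (i + 1)
    have := hB₂.aemeasurable (j + 1)
    exact AEMeasurable.aestronglyMeasurable (by fun_prop)
  refine Eq.trans (integral_congr_ae (ae_of_all _ fun ω ↦ ?_))
    (h.integral_mul_eq_mul_integral hm₁ hm₂)
  simp only [summand, Pi.mul_apply, Function.comp_apply]
  ring

lemma integral_diagPart (hB₁ : IsFractionalBrownianMotion B₁ H₁ P)
    (hB₂ : IsFractionalBrownianMotion B₂ H₂ P) (hH₁ : 0 < H₁) (hH₂ : 0 < H₂)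
    (hindep : IndepFun (fun ω t ↦ B₁ t ω) (fun ω t ↦ B₂ t ω) P) (α : ℝ) (n : ℕ) :
    ∫ ω, diagPart B₁ B₂ α n ω ∂P = (2 * Real.pi)⁻¹ * ∑ i ∈ Finset.range n,
      (Real.sqrt (1 + 2 * ((n : ℝ) ^ α) ^ 2 * (i : ℝ) ^ (2 * H₁)))⁻¹ := by
  rw [diagPart_eq, integral_finsetSum _ fun i _ ↦
    integrable_summand_mul_summand hB₁ hB₂ α n i i, Finset.mul_sum]
  refine Finset.sum_congr rfl fun i _ ↦ ?_
  rw [integral_summand_mul_summand hB₁ hB₂ hindep]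
  simp only [← pow_two]
  rw [hB₁.integral_K_sq hH₁, hB₂.integral_unit_increment_sq hH₂]
  simp

/-- The bound for the expectations of the off-diagonal terms, as a function of the smaller index. -/
noncomputable def rowBound (H α : ℝ) (n i : ℕ) : ℝ :=
  if i = 0 then (n : ℝ) ^ (-α)
  else (Real.sqrt (2 - 2 ^ H))⁻¹ * (n : ℝ) ^ (-2 * α) * (i : ℝ) ^ (-H)

lemma rowBound_nonneg (H α : ℝ) (n i : ℕ) : 0 ≤ rowBound H α n i := by
  unfold rowBound
  split_ifs <;> positivity

/-- The gap is `k + 1`: the kernels give it the exponent `-H₁`, the increments `2H₂ - 2`. The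
product form is the one required by `sum_offDiag_range_le`. -/
lemma abs_integral_summand_mul_summand_le (hB₁ : IsFractionalBrownianMotion B₁ H₁ P)
    (hB₂ : IsFractionalBrownianMotion B₂ H₂ P) (hH₁ : H₁ ∈ Set.Ioo (0 : ℝ) 1)
    (hH₂ : H₂ ∈ Set.Ioo (0 : ℝ) 1)
    (hindep : IndepFun (fun ω t ↦ B₁ t ω) (fun ω t ↦ B₂ t ω) P) (α : ℝ) {n : ℕ} (hn : 0 < n)
    (i k : ℕ) :
    |∫ ω, summand B₁ B₂ α n i ω * summand B₁ B₂ α n (i + 1 + k) ω ∂P| ≤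
      rowBound H₁ α n i * ((k : ℝ) + 1) ^ (2 * H₂ - 2 - H₁) := by
  have hn' : (0 : ℝ) < n := by exact_mod_cast hn
  have hk : (0 : ℝ) < k + 1 := by positivity
  have ha : 0 < (n : ℝ) ^ α := by positivity
  have hr : ((i + 1 + k : ℕ) : ℝ≥0) = (i : ℝ≥0) + ((k + 1 : ℕ) : ℝ≥0) := by push_cast; ring
  rw [integral_summand_mul_summand hB₁ hB₂ hindep, abs_mul, hr,
    show 2 * H₂ - 2 - H₁ = -H₁ + (2 * H₂ - 2) by ring, Real.rpow_add hk, ← mul_assoc]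
  have hinc := hB₂.abs_integral_unit_increment_mul_le hH₂.1 hH₂.2 (i : ℝ≥0)
    (r := ((k + 1 : ℕ) : ℝ≥0)) (by simp)
  have hnn : 0 ≤ ∫ ω, K ((n : ℝ) ^ α * B₁ (i : ℝ≥0) ω) *
      K ((n : ℝ) ^ α * B₁ ((i : ℝ≥0) + ((k + 1 : ℕ) : ℝ≥0)) ω) ∂P :=
    integral_nonneg fun ω ↦ mul_nonneg (K_nonneg _) (K_nonneg _)
  have hcast : (((k + 1 : ℕ) : ℝ≥0) : ℝ) = k + 1 := by push_cast; rfl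
  rw [hcast] at hinc
  rw [abs_of_nonneg hnn]
  refine mul_le_mul ?_ hinc (abs_nonneg _)
    (mul_nonneg (rowBound_nonneg _ _ _ _) (by positivity))
  rcases Nat.eq_zero_or_pos i with rfl | hi
  · have h := hB₁.integral_K_mul_K_le_one hH₁.1 ha ((0 : ℕ) : ℝ≥0)
      (t := ((0 : ℕ) : ℝ≥0) + ((k + 1 : ℕ) : ℝ≥0)) (by positivity)
    rw [NNReal.coe_add, hcast] at h
    simpa [rowBound, Real.rpow_neg hn'.le] using h
  · have h := hB₁.integral_K_mul_K_add_le hH₁.1 hH₁.2 ha (s := (i : ℝ≥0))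
      (r := ((k + 1 : ℕ) : ℝ≥0)) (by positivity) (by positivity)
    rw [hcast] at h
    rw [rowBound, if_neg hi.ne', show -2 * α = -(α * (2 : ℕ)) by push_cast; ring,
      Real.rpow_neg hn'.le, Real.rpow_mul_natCast hn'.le]
    exact h

end

/-! ### Asymptotics -/

lemma tendsto_natCast_rpow_of_neg {p : ℝ} (hp : p < 0) :
    Tendsto (fun n : ℕ ↦ (n : ℝ) ^ p) atTop (𝓝 0) := by
  have h := (tendsto_rpow_neg_atTop (neg_pos.2 hp)).comp (tendsto_natCast_atTop_atTop (R := ℝ))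
  rw [neg_neg] at h
  exact h

lemma sum_rowBound_le {H : ℝ} (hH0 : 0 ≤ H) (hH1 : H < 1) (α : ℝ) {n : ℕ} (hn : 0 < n) :
    ∑ i ∈ Finset.range n, rowBound H α n i ≤ (n : ℝ) ^ (-α) +
      (Real.sqrt (2 - 2 ^ H))⁻¹ * (n : ℝ) ^ (-2 * α) * ((n : ℝ) ^ (1 - H) / (1 - H)) := by
  obtain ⟨m, rfl⟩ := Nat.exists_eq_add_of_lt hn
  rw [zero_add, Finset.sum_range_succ', add_comm]
  have h1H : 0 < 1 - H := by linarith
  refine add_le_add (by simp [rowBound]) ?_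
  simp only [rowBound, Nat.add_eq_zero_iff, one_ne_zero, and_false, if_false]
  rw [← Finset.mul_sum]
  refine mul_le_mul_of_nonneg_left ?_ (by positivity)
  have h := sum_rpow_sub_one_le h1H (by linarith) m
  calc ∑ i ∈ Finset.range m, ((i + 1 : ℕ) : ℝ) ^ (-H)
      = ∑ k ∈ Finset.range m, ((k : ℝ) + 1) ^ (1 - H - 1) :=
        Finset.sum_congr rfl fun k _ ↦ by push_cast; congr 1; ring
    _ ≤ (m : ℝ) ^ (1 - H) / (1 - H) := h
    _ ≤ _ := by
        gcongr
        simp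

/-- Raising the gap exponent `2H₂ - 2 - H₁` to `δ - 1` with `δ > 0` treats convergent, logarithmic
and divergent gap sums at once. -/
lemma abs_integral_offDiagPart_le {B₁ B₂ : ℝ≥0 → Ω → ℝ} {H₁ H₂ : ℝ}
    (hB₁ : IsFractionalBrownianMotion B₁ H₁ P) (hB₂ : IsFractionalBrownianMotion B₂ H₂ P)
    (hH₁ : H₁ ∈ Set.Ioo (0 : ℝ) 1) (hH₂ : H₂ ∈ Set.Ioo (0 : ℝ) 1)
    (hindep : IndepFun (fun ω t ↦ B₁ t ω) (fun ω t ↦ B₂ t ω) P) (α : ℝ) {δ : ℝ} (hδ0 : 0 < δ)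
    (hδ1 : δ ≤ 1) (hδ : 2 * H₂ - 1 - H₁ ≤ δ) {n : ℕ} (hn : 0 < n) :
    |∫ ω, offDiagPart B₁ B₂ α n ω ∂P| ≤ 2 * (((n : ℝ) ^ (-α) +
      (Real.sqrt (2 - 2 ^ H₁))⁻¹ * (n : ℝ) ^ (-2 * α) * ((n : ℝ) ^ (1 - H₁) / (1 - H₁))) *
        ((n : ℝ) ^ δ / δ)) := by
  have h1H : 0 < 1 - H₁ := by linarith [hH₁.2]
  unfold offDiagPart
  rw [integral_finsetSum _ fun p _ ↦ integrable_summand_mul_summand hB₁ hB₂ α n p.1 p.2]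
  refine (Finset.abs_sum_le_sum_abs _ _).trans ?_
  refine (sum_offDiag_range_le
    (f := fun i j ↦ |∫ ω, summand B₁ B₂ α n i ω * summand B₁ B₂ α n j ω ∂P|)
    (fun i j ↦ by simp only [mul_comm]) (rowBound_nonneg H₁ α n)
    (G := fun k ↦ ((k : ℝ) + 1) ^ (δ - 1)) (fun k ↦ by positivity) (fun i k ↦ ?_) n).trans ?_
  · refine (abs_integral_summand_mul_summand_le hB₁ hB₂ hH₁ hH₂ hindep α hn i k).trans ?_
    refine mul_le_mul_of_nonneg_left ?_ (rowBound_nonneg _ _ _ _)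
    exact Real.rpow_le_rpow_of_exponent_le (by linarith [k.cast_nonneg (α := ℝ)]) (by linarith)
  · have h1 := sum_rowBound_le hH₁.1.le hH₁.2 α hn
    have h2 := sum_rpow_sub_one_le hδ0 hδ1 n
    gcongr

lemma tendsto_integral_offDiagPart {B₁ B₂ : ℝ≥0 → Ω → ℝ} {H₁ H₂ α : ℝ}
    (hB₁ : IsFractionalBrownianMotion B₁ H₁ P) (hB₂ : IsFractionalBrownianMotion B₂ H₂ P)
    (hH₁ : H₁ ∈ Set.Ioo (0 : ℝ) 1) (hH₂ : H₂ ∈ Set.Ioo (0 : ℝ) 1)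
    (hindep : IndepFun (fun ω t ↦ B₁ t ω) (fun ω t ↦ B₂ t ω) P) (hα : 0 < α)
    (hcond : 2 * H₂ - 1 - H₁ < α) :
    Tendsto (fun n : ℕ ↦ (n : ℝ) ^ (α + H₁ - 1) * ∫ ω, offDiagPart B₁ B₂ α n ω ∂P)
      atTop (𝓝 0) := by
  obtain ⟨hH₁0, hH₁1⟩ := hH₁
  have hH₂1 := hH₂.2
  -- The lower constraints make the sum over gaps at most `n^δ/δ`. The upper ones make both rescaled
  -- exponents negative: `H₁ - 1 + δ` from the row `i = 0`, `-α + δ` from the others.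
  obtain ⟨δ, hδl, hδr⟩ := exists_between (a₁ := max 0 (2 * H₂ - 1 - H₁)) (a₂ := min α (1 - H₁))
    (max_lt (lt_min hα (by linarith)) (lt_min hcond (by linarith)))
  obtain ⟨hδ0, hδ⟩ := max_lt_iff.1 hδl
  obtain ⟨hδα, hδH⟩ := lt_min_iff.1 hδr
  set C := (Real.sqrt (2 - 2 ^ H₁))⁻¹ / (1 - H₁)
  have hlim : Tendsto (fun n : ℕ ↦ 2 / δ * ((n : ℝ) ^ (H₁ - 1 + δ) + C * (n : ℝ) ^ (-α + δ)))
      atTop (𝓝 0) := by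
    simpa using ((tendsto_natCast_rpow_of_neg (p := H₁ - 1 + δ) (by linarith)).add
      ((tendsto_natCast_rpow_of_neg (p := -α + δ) (by linarith)).const_mul C)).const_mul (2 / δ)
  refine squeeze_zero_norm' ?_ hlim
  filter_upwards [eventually_gt_atTop 0] with n hn
  have hn' : (0 : ℝ) < n := by exact_mod_cast hn
  have h := abs_integral_offDiagPart_le hB₁ hB₂ ⟨hH₁0, hH₁1⟩ hH₂ hindep α hδ0 (by linarith)
    hδ.le hn
  rw [norm_mul, Real.norm_of_nonneg (by positivity), Real.norm_eq_abs]
  refine (mul_le_mul_of_nonneg_left h (by positivity)).trans (le_of_eq ?_)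
  rw [show H₁ - 1 + δ = (α + H₁ - 1) + -α + δ by ring,
    show -α + δ = (α + H₁ - 1) + (-2 * α) + (1 - H₁) + δ by ring]
  simp only [Real.rpow_add hn' _ δ, Real.rpow_add hn' (α + H₁ - 1) (-α),
    Real.rpow_add hn' _ (1 - H₁), Real.rpow_add hn' (α + H₁ - 1) (-2 * α)]
  ring

/-- Replacing `1 + 2 a² x²` by `2 a² x²` costs a factor which tends to `1` as `a → ∞`. -/
lemma inv_sqrt_one_add_bounds {a x : ℝ} (ha : 0 < a) (hx : 1 ≤ x) :
    (Real.sqrt (2 + (a ^ 2)⁻¹))⁻¹ * (a⁻¹ * x⁻¹) ≤ (Real.sqrt (1 + 2 * a ^ 2 * x ^ 2))⁻¹ ∧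
      (Real.sqrt (1 + 2 * a ^ 2 * x ^ 2))⁻¹ ≤ (Real.sqrt 2)⁻¹ * (a⁻¹ * x⁻¹) := by
  have hx0 : 0 < x := by linarith
  have h : ∀ c : ℝ, 0 ≤ c → Real.sqrt (c * (a * x) ^ 2) = Real.sqrt c * (a * x) := fun c hc ↦ by
    rw [Real.sqrt_mul hc, Real.sqrt_sq (by positivity)]
  rw [← mul_inv, ← mul_inv, ← mul_inv, ← h _ (by positivity), ← h _ (by positivity)]
  constructor
  · gcongr
    rw [show (2 + (a ^ 2)⁻¹) * (a * x) ^ 2 = x ^ 2 + 2 * a ^ 2 * x ^ 2 by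
      field_simp
      ring]
    nlinarith
  · gcongr
    nlinarith

lemma sum_inv_sqrt_bounds {H : ℝ} (hH0 : 0 < H) (hH1 : H < 1) (α : ℝ) {n : ℕ} (hn : 0 < n) :
    (Real.sqrt (2 + (((n : ℝ) ^ α) ^ 2)⁻¹))⁻¹ * ((1 - (n : ℝ) ^ (H - 1)) / (1 - H)) ≤
      (n : ℝ) ^ (α + H - 1) * ∑ i ∈ Finset.range n,
        (Real.sqrt (1 + 2 * ((n : ℝ) ^ α) ^ 2 * (i : ℝ) ^ (2 * H)))⁻¹ ∧
    (n : ℝ) ^ (α + H - 1) * ∑ i ∈ Finset.range n,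
        (Real.sqrt (1 + 2 * ((n : ℝ) ^ α) ^ 2 * (i : ℝ) ^ (2 * H)))⁻¹ ≤
      (n : ℝ) ^ (α + H - 1) + (Real.sqrt 2)⁻¹ * (1 / (1 - H)) := by
  have hn' : (0 : ℝ) < n := by exact_mod_cast hn
  obtain ⟨m, hm⟩ := Nat.exists_eq_add_of_lt hn
  rw [zero_add] at hm
  have hmn : (n : ℝ) = m + 1 := by rw [hm]; push_cast; rfl
  have h1H : 0 < 1 - H := by linarith
  set a := (n : ℝ) ^ α with ha_def
  have ha : 0 < a := by positivity
  have hlow := le_sum_rpow_sub_one h1H (by linarith) m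
  have hup := sum_rpow_sub_one_le h1H (by linarith) m
  set T := ∑ k ∈ Finset.range m, ((k : ℝ) + 1) ^ (1 - H - 1) with hT
  have hterm : ∀ k : ℕ, ((k : ℝ) + 1) ^ (1 - H - 1) = (((k : ℝ) + 1) ^ H)⁻¹ := fun k ↦ by
    rw [← Real.rpow_neg (by positivity)]
    congr 1
    ring
  have hsq : ∀ k : ℕ, ((k : ℝ) + 1) ^ (2 * H) = (((k : ℝ) + 1) ^ H) ^ 2 := fun k ↦ by
    rw [← Real.rpow_mul_natCast (by positivity)]
    congr 1
    push_cast
    ring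
  have hbd := fun k : ℕ ↦ inv_sqrt_one_add_bounds ha
    (Real.one_le_rpow (x := (k : ℝ) + 1) (z := H) (by linarith [k.cast_nonneg (α := ℝ)]) hH0.le)
  -- The index `0` contributes exactly `1`: the lower bound drops it, and the upper bound keeps it
  -- as the error `n^(α+H-1)`.
  have hsum : ∑ i ∈ Finset.range n, (Real.sqrt (1 + 2 * a ^ 2 * (i : ℝ) ^ (2 * H)))⁻¹ =
      1 + ∑ k ∈ Finset.range m, (Real.sqrt (1 + 2 * a ^ 2 * (((k : ℝ) + 1) ^ H) ^ 2))⁻¹ := by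
    rw [hm, Finset.sum_range_succ', add_comm]
    simp [Real.zero_rpow (show (2 * H) ≠ 0 by positivity), hsq]
  have h1 : (Real.sqrt (2 + (a ^ 2)⁻¹))⁻¹ * (a⁻¹ * T) ≤
      ∑ k ∈ Finset.range m, (Real.sqrt (1 + 2 * a ^ 2 * (((k : ℝ) + 1) ^ H) ^ 2))⁻¹ := by
    rw [hT, Finset.mul_sum, Finset.mul_sum]
    exact Finset.sum_le_sum fun k _ ↦ by rw [hterm]; exact (hbd k).1
  have h2 : ∑ k ∈ Finset.range m, (Real.sqrt (1 + 2 * a ^ 2 * (((k : ℝ) + 1) ^ H) ^ 2))⁻¹ ≤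
      (Real.sqrt 2)⁻¹ * (a⁻¹ * T) := by
    rw [hT, Finset.mul_sum, Finset.mul_sum]
    exact Finset.sum_le_sum fun k _ ↦ by rw [hterm]; exact (hbd k).2
  have hpow : (n : ℝ) ^ (α + H - 1) = a * (n : ℝ) ^ (H - 1) := by
    rw [ha_def, ← Real.rpow_add hn']
    congr 1
    ring
  have hone : (n : ℝ) ^ (H - 1) * (n : ℝ) ^ (1 - H) = 1 := by
    rw [← Real.rpow_add hn', show H - 1 + (1 - H) = 0 by ring, Real.rpow_zero]
  have hb : 0 < (n : ℝ) ^ (H - 1) := by positivity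
  rw [hsum, hpow]
  rw [← hmn] at hlow
  have hup' : T ≤ (n : ℝ) ^ (1 - H) / (1 - H) := by
    refine hup.trans ?_
    gcongr
    linarith
  constructor
  · calc (Real.sqrt (2 + (a ^ 2)⁻¹))⁻¹ * ((1 - (n : ℝ) ^ (H - 1)) / (1 - H))
        = a * (n : ℝ) ^ (H - 1) * ((Real.sqrt (2 + (a ^ 2)⁻¹))⁻¹ *
            (a⁻¹ * (((n : ℝ) ^ (1 - H) - 1) / (1 - H)))) := by
          rw [eq_inv_of_mul_eq_one_right hone]
          generalize (n : ℝ) ^ (H - 1) = b at hb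
          field_simp
      _ ≤ a * (n : ℝ) ^ (H - 1) * ((Real.sqrt (2 + (a ^ 2)⁻¹))⁻¹ * (a⁻¹ * T)) := by gcongr
      _ ≤ a * (n : ℝ) ^ (H - 1) * (1 + _) := by
          gcongr
          linarith
  · calc _ ≤ a * (n : ℝ) ^ (H - 1) * (1 + (Real.sqrt 2)⁻¹ *
            (a⁻¹ * ((n : ℝ) ^ (1 - H) / (1 - H)))) := by
          gcongr
          refine h2.trans ?_
          gcongr
      _ = _ := by
          rw [eq_inv_of_mul_eq_one_right hone]
          generalize (n : ℝ) ^ (H - 1) = b at hb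
          field_simp

lemma tendsto_integral_diagPart {B₁ B₂ : ℝ≥0 → Ω → ℝ} {H₁ H₂ α : ℝ}
    (hB₁ : IsFractionalBrownianMotion B₁ H₁ P) (hB₂ : IsFractionalBrownianMotion B₂ H₂ P)
    (hH₁ : H₁ ∈ Set.Ioo (0 : ℝ) 1) (hH₂ : 0 < H₂)
    (hindep : IndepFun (fun ω t ↦ B₁ t ω) (fun ω t ↦ B₂ t ω) P) (hα : 0 < α)
    (hαH : α < 1 - H₁) :
    Tendsto (fun n : ℕ ↦ (n : ℝ) ^ (α + H₁ - 1) * ∫ ω, diagPart B₁ B₂ α n ω ∂P)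
      atTop (𝓝 (1 / (2 * Real.pi * Real.sqrt 2 * (1 - H₁)))) := by
  have hpow : Tendsto (fun n : ℕ ↦ (((n : ℝ) ^ α) ^ 2)⁻¹) atTop (𝓝 0) :=
    tendsto_inv_atTop_zero.comp ((tendsto_pow_atTop two_ne_zero).comp
      ((tendsto_rpow_atTop hα).comp tendsto_natCast_atTop_atTop))
  have hsqrt : Tendsto (fun n : ℕ ↦ (Real.sqrt (2 + (((n : ℝ) ^ α) ^ 2)⁻¹))⁻¹) atTop
      (𝓝 (Real.sqrt 2)⁻¹) := by
    have h := (hpow.const_add 2).sqrt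
    rw [add_zero] at h
    exact h.inv₀ (by positivity)
  have hlow : Tendsto (fun n : ℕ ↦ (Real.sqrt (2 + (((n : ℝ) ^ α) ^ 2)⁻¹))⁻¹ *
      ((1 - (n : ℝ) ^ (H₁ - 1)) / (1 - H₁))) atTop (𝓝 ((Real.sqrt 2)⁻¹ * (1 / (1 - H₁)))) := by
    have h := ((tendsto_natCast_rpow_of_neg (p := H₁ - 1) (by linarith [hH₁.2])).const_sub
      1).div_const (1 - H₁)
    rw [sub_zero] at h
    exact hsqrt.mul h
  -- Here `α < 1 - H₁` enters: it makes the contribution of the index `0` vanish.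
  have hup : Tendsto (fun n : ℕ ↦ (n : ℝ) ^ (α + H₁ - 1) + (Real.sqrt 2)⁻¹ * (1 / (1 - H₁)))
      atTop (𝓝 ((Real.sqrt 2)⁻¹ * (1 / (1 - H₁)))) := by
    simpa using (tendsto_natCast_rpow_of_neg (p := α + H₁ - 1) (by linarith)).add_const
      ((Real.sqrt 2)⁻¹ * (1 / (1 - H₁)))
  have hmain := (tendsto_of_tendsto_of_tendsto_of_le_of_le' hlow hup
    ((eventually_gt_atTop 0).mono fun n hn ↦ (sum_inv_sqrt_bounds hH₁.1 hH₁.2 α hn).1)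
    ((eventually_gt_atTop 0).mono fun n hn ↦ (sum_inv_sqrt_bounds hH₁.1 hH₁.2 α hn).2)).const_mul
      (2 * Real.pi)⁻¹
  convert hmain using 2 with n
  · rw [integral_diagPart hB₁ hB₂ hH₁.1 hH₂ hindep]
    ring
  · rw [one_div, one_div, mul_inv, mul_inv _ (Real.sqrt 2)]
    ring

end FBMRegression

theorem mainTheorem5 {Ω : Type*} [MeasurableSpace Ω] (P : Measure Ω) [IsProbabilityMeasure P]
    (H₁ H₂ α : ℝ) (hH₁ : H₁ ∈ Set.Ioo (0 : ℝ) 1) (hH₂ : H₂ ∈ Set.Ioo (0 : ℝ) 1)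
    (B₁ B₂ : ℝ≥0 → Ω → ℝ)
    (hB₁ : FBMRegression.IsFractionalBrownianMotion B₁ H₁ P)
    (hB₂ : FBMRegression.IsFractionalBrownianMotion B₂ H₂ P)
    (hindep : IndepFun (fun ω t ↦ B₁ t ω) (fun ω t ↦ B₂ t ω) P)
    (hα : 0 < α) (hcond : 0 < α - 4 * H₂ + H₁ + 2) :
    -- all the expectations are well defined, and `E (S n ^ 2)` splits into its two parts
    (∀ n : ℕ, MemLp (FBMRegression.S B₁ B₂ α n) 2 P ∧
      Integrable (FBMRegression.diagPart B₁ B₂ α n) P ∧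
      Integrable (FBMRegression.offDiagPart B₁ B₂ α n) P ∧
      ∫ ω, FBMRegression.S B₁ B₂ α n ω ^ 2 ∂P =
        ∫ ω, FBMRegression.diagPart B₁ B₂ α n ω ∂P +
          ∫ ω, FBMRegression.offDiagPart B₁ B₂ α n ω ∂P) ∧
    -- the off-diagonal part is negligible
    Tendsto (fun n : ℕ ↦ (n : ℝ) ^ (α + H₁ - 1) *
      ∫ ω, FBMRegression.offDiagPart B₁ B₂ α n ω ∂P) atTop (𝓝 0) ∧
    -- the diagonal part, and hence `E (S n ^ 2)`, has the announced limit
    (α < 1 - H₁ →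
      Tendsto (fun n : ℕ ↦ (n : ℝ) ^ (α + H₁ - 1) *
        ∫ ω, FBMRegression.diagPart B₁ B₂ α n ω ∂P) atTop
        (𝓝 (1 / (2 * Real.pi * Real.sqrt 2 * (1 - H₁)))) ∧
      Tendsto (fun n : ℕ ↦ (n : ℝ) ^ (α + H₁ - 1) *
        ∫ ω, FBMRegression.S B₁ B₂ α n ω ^ 2 ∂P) atTop
        (𝓝 (1 / (2 * Real.pi * Real.sqrt 2 * (1 - H₁))))) := by
  -- The weaker condition `2H₂ - 1 - H₁ < α` suffices. If `H₂ ≤ 1/2` its left side is negative;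
  -- otherwise `2H₂ - 1 ≤ 4H₂ - 2` and `hcond` gives it.
  have hoff := FBMRegression.tendsto_integral_offDiagPart hB₁ hB₂ hH₁ hH₂ hindep hα
    (by rcases le_total H₂ (1 / 2) with h | h <;> linarith [hH₁.1])
  refine ⟨fun n ↦ ⟨FBMRegression.memLp_S hB₁ hB₂ α n, FBMRegression.integrable_diagPart hB₁ hB₂ α n,
    FBMRegression.integrable_offDiagPart hB₁ hB₂ α n, FBMRegression.integral_sq_S hB₁ hB₂ α n⟩,
    hoff, fun hαH ↦ ?_⟩
  have hdiag := FBMRegression.tendsto_integral_diagPart hB₁ hB₂ hH₁ hH₂.1 hindep hα hαH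
  refine ⟨hdiag, ?_⟩
  simpa only [FBMRegression.integral_sq_S hB₁ hB₂, mul_add, add_zero] using hdiag.add hoff
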